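/- For a finite simple graph $G$, write $d(v)$ for the degree of a vertex $v$ and let $\sigma_t(G)=\sum_{\{u,v\}\subseteq V(G)}(d(u)-d(v))^2$, the sum running over all unordered pairs of distinct vertices. For non-negative integers $a,b$, let $S_{a,b}$ denote the split graph whose vertex set is partitioned into a clique of size $a$ and an independent set of size $b$, with every vertex of the independent set adjacent to every vertex of the clique. Let $n\ge 3$ be an integer. Then every connected simple graph $\Gamma$ on $n$ vertices satisfies $$ \sigma_t(\Gamma)\le \begin{cases} \lceil \frac n4\rceil\cdot\lfloor\frac{3n}4\rfloor\,\bigl(n-1-\lceil\frac n4\rceil\bigr)^2, & \text{if } n\equiv 0 \text{ or } 3 \pmod 4,\\[2pt] \lfloor \frac n4\rfloor\cdot\lceil\frac{3n}4\rceil\,\bigl(n-1-\lfloor\frac n4\rfloor\bigr)^2, & \text{if } n\equiv 1 \text{ or } 2 \pmod 4. \end{cases} $$ If $n\equiv 0$ or $3\pmod 4$, the split graph $S_{\lceil n/4\rceil,\lfloor 3n/4\rfloor}$ is a connected graph on $n$ vertices for which equality holds; if $n\equiv 1$ or $2\pmod 4$, the split graph $S_{\lfloor n/4\rfloor,\lceil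 3n/4\rceil}$ is a connected graph on $n$ vertices for which equality holds. -/

import Mathlib

/-- The `σ_t`-irregularity (sigma total index): the sum of `(d(u) - d(v))²` over all unordered
pairs `{u, v}` of distinct vertices. -/
def SimpleGraph.sigmaTotal {V : Type*} [Fintype V] [DecidableEq V]
    (G : SimpleGraph V) [DecidableRel G.Adj] : ℤ :=
  ∑ e : Sym2 V with ¬ e.IsDiag,
    Sym2.lift ⟨fun u v => ((G.degree u : ℤ) - (G.degree v : ℤ)) ^ 2,
      fun u v => by ring⟩ e

/-- `G` is a split graph `S_{a,b}`: its vertices are partitioned into a clique of size `a` and an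
independent set of size `b`, every vertex of the independent set being adjacent to every vertex of
the clique. -/
def SimpleGraph.IsSplitGraph {V : Type*} [Fintype V] [DecidableEq V]
    (G : SimpleGraph V) (a b : ℕ) : Prop :=
  ∃ A B : Finset V, Disjoint A B ∧ A ∪ B = Finset.univ ∧ A.card = a ∧ B.card = b ∧
    G.IsClique (A : Set V) ∧ G.IsIndepSet (B : Set V) ∧ ∀ u ∈ A, ∀ v ∈ B, G.Adj u v

/-! Expanding the squares gives `σ_t = n ∑ d² - (∑ d)²`, so for a fixed number of edges `∑ d²` is to
be maximized. A maximizer has an isolated or a dominating vertex (`exists_isolated_or_dominating`).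
Peeling such vertices off, with a new maximizer at each stage, bounds `σ_t` by a function
`buildSigma` of a sequence `e` with `e (j+1) - e j ∈ {0, j}` (`exists_isBuildSeq_sigmaTotal_le`).

With `C j = j(j-1)/2`, that function is a main term depending only on `e n`, minus `n` times the
losses `e j (C j - e j) / C j`. It is invariant under `e ↦ C - e`, so at most half of the pairs may
be taken as edges. Write the number of non-edges as `C b + r`, `0 ≤ r ≤ b`. Bounding every loss
below separately gives a telescoping sum and a bound that is a concave quadratic in `r`, equal to
the split graph values for `b` and `b + 1` at the two ends (`IsBuildSeq.buildSigma_le`).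

The quadratic is usually monotone on `[0, b]`, and an endpoint wins. The exceptions are `n = 4m + 2,
b = 3m + 1` and `n = 4m + 3, b = 3m + 2`. There the losses at `b` and `b + 1` cannot both be minimal
(`IsBuildSeq.loss_dichotomy`), and the surplus absorbs the excess. The split graph values are
unimodal in `b`, which locates their maximum. -/

open Finset

/-! ### Maximizers of the sum of squared degrees -/

namespace SimpleGraph

/-- The number of neighbours of `v` inside the finset `s`. -/
noncomputable def degreeIn {V : Type*} (G : SimpleGraph V) (s : Finset V) (v : V) : ℤ :=
  open Classical in ∑ w ∈ s, if G.Adj v w then 1 else 0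

/-- Replace the edge `uw` by the edge `vw`. -/
def moveEdge {V : Type*} (G : SimpleGraph V) (u v w : V) (hvw : v ≠ w) : SimpleGraph V where
  Adj x y := (G.Adj x y ∧ ¬ (x = u ∧ y = w) ∧ ¬ (x = w ∧ y = u)) ∨
    (x = v ∧ y = w) ∨ (x = w ∧ y = v)
  symm := ⟨fun x y h => by
    rcases h with ⟨h, h1, h2⟩ | h | h
    · exact Or.inl ⟨h.symm, by tauto, by tauto⟩
    · tauto
    · tauto⟩
  loopless := ⟨fun x h => by
    rcases h with ⟨h, -, -⟩ | ⟨rfl, h⟩ | ⟨rfl, h⟩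
    · exact G.irrefl h
    · exact hvw h
    · exact hvw h.symm⟩

variable {V : Type*} [DecidableEq V]

theorem degreeIn_moveEdge (G : SimpleGraph V) {s : Finset V} {u v w : V} (hvw : v ≠ w)
    (huv : u ≠ v) (hu : u ∈ s) (hv : v ∈ s) (hw : w ∈ s) (huw : G.Adj u w) (hnvw : ¬ G.Adj v w)
    (x : V) :
    (G.moveEdge u v w hvw).degreeIn s x =
      G.degreeIn s x + (if x = v then 1 else 0) - (if x = u then 1 else 0) := by
  classical
  have huw' : u ≠ w := huw.ne
  have key : ∀ y, (if (G.moveEdge u v w hvw).Adj x y then (1 : ℤ) else 0) =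
      (if G.Adj x y then 1 else 0) + (if x = v then (if y = w then 1 else 0) else 0)
        + (if x = w then (if y = v then 1 else 0) else 0)
        - (if x = u then (if y = w then 1 else 0) else 0)
        - (if x = w then (if y = u then 1 else 0) else 0) := by
    intro y
    simp only [moveEdge]
    have h1 := huw.symm
    have h2 : ¬ G.Adj w v := fun h => hnvw h.symm
    by_cases hxv : x = v
    · subst hxv
      by_cases hy : y = w
      · subst hy; simp [hnvw, hvw, huv.symm]
      · simp [hy, hvw, huv.symm]
    · by_cases hxu : x = u
      · subst hxu
        by_cases hy : y = w
        · subst hy; simp [huw, huw', hxv]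
        · simp [hy, hxv, huw']
      · by_cases hxw : x = w
        · subst hxw
          by_cases hy : y = v
          · subst hy; simp [h2, hvw.symm, huv.symm, huw'.symm]
          · by_cases hy' : y = u
            · subst hy'; simp [h1, hy, hxv, hxu]
            · simp [hy, hy', hxv, hxu]
        · simp [hxv, hxu, hxw]
  unfold degreeIn
  rw [sum_congr rfl fun y _ => key y]
  simp only [sum_add_distrib, sum_sub_distrib]
  by_cases hxw : x = w
  · subst hxw; simp [hu, hv, hvw.symm, huw'.symm]
  · simp only [if_neg hxw]
    by_cases hxv : x = v <;> by_cases hxu : x = u <;> simp [hxv, hxu, hw]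

/-- Among the graphs with a given degree sum, one maximizing the sum of the squared degrees has
an isolated or a dominating vertex. -/
theorem exists_isolated_or_dominating {s : Finset V} (hs : s.Nonempty) (G : SimpleGraph V)
    (hmax : ∀ H : SimpleGraph V, ∑ v ∈ s, H.degreeIn s v = ∑ v ∈ s, G.degreeIn s v →
      ∑ v ∈ s, H.degreeIn s v ^ 2 ≤ ∑ v ∈ s, G.degreeIn s v ^ 2) :
    ∃ v ∈ s, (∀ w ∈ s, ¬ G.Adj v w) ∨ (∀ w ∈ s, w ≠ v → G.Adj v w) := by
  -- If `v` of maximal degree misses some `w`, and `w` has a neighbour `u`, then moving the edge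
  -- `uw` to `vw` changes `∑ d²` by `2 (d v - d u) + 2 > 0`.
  obtain ⟨v, hv, hvmax⟩ := exists_max_image s (G.degreeIn s) hs
  by_contra! hcon
  obtain ⟨-, w, hw, hwv, hnvw⟩ := hcon v hv
  obtain ⟨⟨u, hu, hwu⟩, -⟩ := hcon w hw
  have huv : u ≠ v := by rintro rfl; exact hnvw hwu.symm
  have hdeg := G.degreeIn_moveEdge hwv.symm huv hu hv hw hwu.symm hnvw
  have h1 : ∀ x, (G.moveEdge u v w hwv.symm).degreeIn s x ^ 2 = G.degreeIn s x ^ 2 +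
      (if x = v then 2 * G.degreeIn s v + 1 else 0)
        - (if x = u then 2 * G.degreeIn s u - 1 else 0) := by
    intro x
    rw [hdeg]
    by_cases hxv : x = v
    · subst hxv; simp [huv.symm]; ring
    · by_cases hxu : x = u
      · subst hxu; simp [hxv]; ring
      · simp [hxv, hxu]
  have h2 := hmax (G.moveEdge u v w hwv.symm) (by
    rw [sum_congr rfl fun x _ => hdeg x]
    simp [sum_add_distrib, sum_sub_distrib, hu, hv])
  rw [sum_congr rfl fun x _ => h1 x] at h2
  simp only [sum_add_distrib, sum_sub_distrib, sum_ite_eq', hu, hv, if_true] at h2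
  have := hvmax u hu
  linarith

/-! ### Adding an isolated or a dominating vertex -/

theorem degreeIn_insert (G : SimpleGraph V) {s : Finset V} {v : V} (hv : v ∉ s) (x : V) :
    open Classical in
    G.degreeIn (insert v s) x = (if G.Adj x v then 1 else 0) + G.degreeIn s x := by
  classical
  unfold degreeIn
  rw [sum_insert hv]

theorem degreeIn_self_insert (G : SimpleGraph V) {s : Finset V} {v : V} (hv : v ∉ s) :
    G.degreeIn (insert v s) v = G.degreeIn s v := by
  rw [degreeIn_insert G hv]; simp

theorem sums_insert_isolated (G : SimpleGraph V) {s : Finset V} {v : V} (hv : v ∉ s)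
    (h : ∀ w ∈ s, ¬ G.Adj v w) :
    ∑ x ∈ insert v s, G.degreeIn (insert v s) x = ∑ x ∈ s, G.degreeIn s x ∧
    ∑ x ∈ insert v s, G.degreeIn (insert v s) x ^ 2 = ∑ x ∈ s, G.degreeIn s x ^ 2 := by
  classical
  have h0 : G.degreeIn s v = 0 := sum_eq_zero fun w hw => if_neg (h w hw)
  have h1 : ∀ x ∈ s, G.degreeIn (insert v s) x = G.degreeIn s x := fun x hx => by
    rw [degreeIn_insert G hv, if_neg fun hadj => h x hx hadj.symm, zero_add]
  constructor
  · rw [sum_insert hv, degreeIn_self_insert G hv, h0, zero_add, sum_congr rfl h1]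
  · rw [sum_insert hv, degreeIn_self_insert G hv, h0]
    rw [sum_congr rfl fun x hx => by rw [h1 x hx]]
    ring

theorem sums_insert_dominating (G : SimpleGraph V) {s : Finset V} {v : V} (hv : v ∉ s)
    (h : ∀ w ∈ s, G.Adj v w) :
    ∑ x ∈ insert v s, G.degreeIn (insert v s) x = ∑ x ∈ s, G.degreeIn s x + 2 * #s ∧
    ∑ x ∈ insert v s, G.degreeIn (insert v s) x ^ 2 =
      ∑ x ∈ s, G.degreeIn s x ^ 2 + 2 * ∑ x ∈ s, G.degreeIn s x + #s + (#s : ℤ) ^ 2 := by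
  classical
  have h0 : G.degreeIn s v = #s := by
    unfold degreeIn
    rw [sum_congr rfl fun w hw => if_pos (h w hw)]; simp
  have h1 : ∀ x ∈ s, G.degreeIn (insert v s) x = 1 + G.degreeIn s x := fun x hx => by
    rw [degreeIn_insert G hv, if_pos (h x hx).symm]
  constructor
  · rw [sum_insert hv, degreeIn_self_insert G hv, h0, sum_congr rfl h1, sum_add_distrib]
    simp; ring
  · rw [sum_insert hv, degreeIn_self_insert G hv, h0]
    rw [sum_congr rfl fun x hx => by
      rw [h1 x hx, show (1 + G.degreeIn s x) ^ 2 =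
        1 + 2 * G.degreeIn s x + G.degreeIn s x ^ 2 by ring]]
    simp only [sum_add_distrib, ← mul_sum]
    simp; ring

end SimpleGraph

/-! ### Build sequences -/

/-- The number of pairs from a `j`-element set, as a rational number. -/
def pairCount (j : ℕ) : ℚ := j * (j - 1) / 2

theorem pairCount_succ (j : ℕ) : pairCount (j + 1) = pairCount j + j := by
  unfold pairCount; push_cast; ring

/-- `e j` is the number of edges among the first `j` vertices of a graph on `k` vertices that is
built by adding isolated and dominating vertices one at a time. -/
structure IsBuildSeq (k : ℕ) (e : ℕ → ℚ) : Prop where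
  zero : e 0 = 0
  step : ∀ j < k, e (j + 1) = e j ∨ e (j + 1) = e j + j

/-- The sum of the squared degrees of the graph with build sequence `e`. -/
def buildSq (k : ℕ) (e : ℕ → ℚ) : ℚ :=
  2 * (k - 1) * e k - 2 * e k * (pairCount k - e k) / (k - 1) -
    ∑ j ∈ range k, e j * (pairCount j - e j) / pairCount j

theorem IsBuildSeq.one {k : ℕ} {e : ℕ → ℚ} (h : IsBuildSeq k e) (hk : 0 < k) : e 1 = 0 := by
  have := h.step 0 hk
  simpa [h.zero] using this

/-- These increments match `sums_insert_isolated` and `sums_insert_dominating`, as the degree sum is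
`2 * e k`; this justifies the closed form `buildSq`. For `k ≤ 1` the value `pairCount k` is zero, so
division by it gives `0` and these cases are separate. -/
theorem IsBuildSeq.buildSq_succ {k : ℕ} {e : ℕ → ℚ} (h : IsBuildSeq (k + 1) e) :
    (e (k + 1) = e k → buildSq (k + 1) e = buildSq k e) ∧
    (e (k + 1) = e k + k → buildSq (k + 1) e = buildSq k e + 4 * e k + k + (k : ℚ) ^ 2) := by
  unfold buildSq
  rw [sum_range_succ, pairCount_succ]
  rcases Nat.lt_trichotomy k 1 with hk | rfl | hk
  · obtain rfl : k = 0 := by omega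
    have h1 := h.one (by omega)
    simp [h.zero, h1, pairCount]
  · have h1 := h.one (by omega)
    simp only [h1, pairCount]
    constructor <;> intro h2 <;> simp [h2]; norm_num
  · have hk1 : (k : ℚ) - 1 ≠ 0 := by
      have : (1 : ℚ) < k := by exact_mod_cast hk
      linarith
    have hk0 : (k : ℚ) ≠ 0 := by positivity
    constructor <;> intro h2 <;> rw [h2] <;> unfold pairCount <;> push_cast <;>
      simp only [add_sub_cancel_right] <;> field_simp <;> ring

namespace SimpleGraph

/-- Replace `G` by a graph `H` with the same degree sum on `s` and maximal `∑ d²`, remove its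
isolated or dominating vertex, and apply induction to `H` on the remaining set. Each stage chooses a
new maximizer, so the squares are only bounded, while the degree sum is kept exactly. -/
theorem exists_isBuildSeq {V : Type*} [Finite V] [DecidableEq V] (k : ℕ) :
    ∀ (s : Finset V) (G : SimpleGraph V), #s = k → ∃ e : ℕ → ℚ, IsBuildSeq k e ∧
      ((∑ v ∈ s, G.degreeIn s v : ℤ) : ℚ) = 2 * e k ∧
      ((∑ v ∈ s, G.degreeIn s v ^ 2 : ℤ) : ℚ) ≤ buildSq k e := by
  induction k with
  | zero =>
    intro s G hs
    obtain rfl := card_eq_zero.mp hs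
    exact ⟨fun _ => 0, ⟨rfl, by simp⟩, by simp, by simp [buildSq]⟩
  | succ k ih =>
    intro s G hs
    obtain ⟨H, hHS, hH⟩ := Set.exists_max_image
      {H : SimpleGraph V | ∑ v ∈ s, H.degreeIn s v = ∑ v ∈ s, G.degreeIn s v}
      (fun H => ∑ v ∈ s, H.degreeIn s v ^ 2) (Set.toFinite _) ⟨G, rfl⟩
    simp only [Set.mem_ofPred_eq] at hHS hH
    have hne : s.Nonempty := card_pos.mp (by omega)
    obtain ⟨v, hv, hor⟩ := H.exists_isolated_or_dominating hne
      fun K hK => hH K (hK.trans hHS)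
    have hGH := hH G rfl
    obtain ⟨t, hvt, rfl⟩ : ∃ t, v ∉ t ∧ insert v t = s :=
      ⟨s.erase v, notMem_erase v s, insert_erase hv⟩
    rw [card_insert_of_notMem hvt] at hs
    have htk : #t = k := by omega
    obtain ⟨e, he, heS, heq⟩ := ih t H htk
    have hsum : ∀ c, ∑ j ∈ range k, Function.update e (k + 1) c j *
        (pairCount j - Function.update e (k + 1) c j) / pairCount j =
        ∑ j ∈ range k, e j * (pairCount j - e j) / pairCount j := fun c =>
      sum_congr rfl fun j hj => by
        rw [Function.update_of_ne (by have := mem_range.mp hj; omega)]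
    have hk : ∀ c, Function.update e (k + 1) c k = e k := fun c =>
      Function.update_of_ne (by omega) _ _
    have hsq : ∀ c, buildSq k (Function.update e (k + 1) c) = buildSq k e := fun c => by
      unfold buildSq; rw [hsum, hk]
    have hbuild : ∀ c, c = e k ∨ c = e k + k →
        IsBuildSeq (k + 1) (Function.update e (k + 1) c) := fun c hc =>
      ⟨by rw [Function.update_of_ne (by omega), he.zero], fun j hj => by
        rcases Nat.lt_succ_iff_lt_or_eq.mp hj with hj | rfl
        · rw [Function.update_of_ne (by omega), Function.update_of_ne (by omega)]
          exact he.step j hj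
        · rw [hk, Function.update_self]; exact hc⟩
    rcases hor with hiso | hdom
    · obtain ⟨h1, h2⟩ := H.sums_insert_isolated hvt fun w hw => hiso w (mem_insert_of_mem hw)
      refine ⟨_, hbuild (e k) (Or.inl rfl), ?_, ?_⟩
      · rw [← hHS, h1, heS, Function.update_self]
      · rw [(hbuild (e k) (Or.inl rfl)).buildSq_succ.1 (by rw [hk, Function.update_self]), hsq]
        rw [h2] at hGH
        exact le_trans (by exact_mod_cast hGH) heq
    · obtain ⟨h1, h2⟩ := H.sums_insert_dominating hvt fun w hw =>
        hdom w (mem_insert_of_mem hw) (by rintro rfl; exact hvt hw)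
      refine ⟨_, hbuild (e k + k) (Or.inr rfl), ?_, ?_⟩
      · rw [← hHS, h1, Function.update_self, htk]
        push_cast at heS ⊢; linarith
      · rw [(hbuild (e k + k) (Or.inr rfl)).buildSq_succ.2 (by rw [hk, Function.update_self]),
          hsq, hk]
        rw [h2, htk] at hGH
        have hGH' : ((∑ x ∈ insert v t, G.degreeIn (insert v t) x ^ 2 : ℤ) : ℚ) ≤
          ((∑ x ∈ t, H.degreeIn t x ^ 2 : ℤ) : ℚ) + 2 * ((∑ x ∈ t, H.degreeIn t x : ℤ) : ℚ)
            + k + (k : ℚ) ^ 2 := by exact_mod_cast hGH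
        rw [heS] at hGH'
        linarith

end SimpleGraph

/-! ### The irregularity as a variance; split graphs -/

namespace SimpleGraph

theorem degreeIn_univ {V : Type*} [Fintype V] (G : SimpleGraph V) [DecidableRel G.Adj] (v : V) :
    G.degreeIn univ v = G.degree v := by
  classical
  unfold degreeIn
  rw [← card_neighborFinset_eq_degree, neighborFinset_eq_filter, card_filter]
  push_cast
  congr!

variable {V : Type*} [Fintype V] [DecidableEq V]

theorem two_mul_sigmaTotal (G : SimpleGraph V) [DecidableRel G.Adj] :
    2 * G.sigmaTotal = ∑ u, ∑ v, ((G.degree u : ℤ) - G.degree v) ^ 2 := by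
  have h1 : ∑ u, ∑ v, ((G.degree u : ℤ) - G.degree v) ^ 2 =
      ∑ p ∈ (univ : Finset V).offDiag, ((G.degree p.1 : ℤ) - G.degree p.2) ^ 2 := by
    rw [← sum_product', ← diag_union_offDiag, sum_union (disjoint_diag_offDiag _)]
    simp
  rw [h1, sigmaTotal, mul_sum, ← sum_fiberwise_of_maps_to (s := (univ : Finset V).offDiag)
    (t := univ.filter fun e : Sym2 V => ¬ e.IsDiag) (g := fun p => s(p.1, p.2)) (by simp)]
  refine sum_congr rfl fun e he => ?_
  induction e using Sym2.inductionOn with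
  | hf a b =>
    have hab : a ≠ b := by simpa using he
    have : (univ : Finset V).offDiag.filter (fun p => s(p.1, p.2) = s(a, b)) =
        {(a, b), (b, a)} := by
      ext ⟨x, y⟩
      simp only [mem_filter, mem_offDiag, mem_univ, true_and, Sym2.eq_iff, mem_insert,
        mem_singleton, Prod.mk.injEq, ne_eq]
      refine ⟨fun h => h.2, fun h => ⟨?_, h⟩⟩
      rcases h with ⟨rfl, rfl⟩ | ⟨rfl, rfl⟩
      · exact hab
      · exact hab.symm
    rw [this, sum_pair (by simp [hab])]
    simp only [Sym2.lift_mk]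
    ring

theorem sigmaTotal_eq (G : SimpleGraph V) [DecidableRel G.Adj] :
    G.sigmaTotal = Fintype.card V * ∑ v, (G.degree v : ℤ) ^ 2 - (∑ v, (G.degree v : ℤ)) ^ 2 := by
  have h := G.two_mul_sigmaTotal
  have h2 : ∑ u, ∑ v, ((G.degree u : ℤ) - G.degree v) ^ 2 =
      2 * (Fintype.card V * ∑ v, (G.degree v : ℤ) ^ 2 - (∑ v, (G.degree v : ℤ)) ^ 2) := by
    simp only [sub_sq, sum_add_distrib, sum_sub_distrib, ← mul_sum, ← sum_mul, sum_const,
      card_univ, nsmul_eq_mul]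
    ring
  linarith

/-- The `σ_t`-irregularity is bounded by that of a graph built by adding isolated and dominating
vertices. -/
theorem exists_isBuildSeq_sigmaTotal_le (G : SimpleGraph V) [DecidableRel G.Adj]
    (n : ℕ) (hn : 2 ≤ n) (hV : Fintype.card V = n) :
    ∃ e : ℕ → ℚ, IsBuildSeq n e ∧
      (G.sigmaTotal : ℚ) ≤ 2 * (n - 2) / (n - 1) * (e n * (pairCount n - e n)) -
        n * ∑ j ∈ range n, e j * (pairCount j - e j) / pairCount j := by
  obtain ⟨e, he, hS, hq⟩ := exists_isBuildSeq n univ G (by rw [card_univ, hV])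
  refine ⟨e, he, ?_⟩
  simp only [degreeIn_univ] at hS hq
  rw [sigmaTotal_eq, hV]
  push_cast at hS hq ⊢
  rw [hS]
  have hn1 : (n : ℚ) - 1 ≠ 0 := by
    have : (2 : ℚ) ≤ n := by exact_mod_cast hn
    linarith
  have : (n : ℚ) * ∑ v, (G.degree v : ℚ) ^ 2 ≤ n * buildSq n e := by gcongr
  have heq : 2 * ((n : ℚ) - 2) / (n - 1) * (e n * (pairCount n - e n)) -
        n * ∑ j ∈ range n, e j * (pairCount j - e j) / pairCount j =
      n * buildSq n e - (2 * e n) ^ 2 := by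
    unfold buildSq
    have hp : pairCount n = n * (n - 1) / 2 := rfl
    generalize ∑ j ∈ range n, e j * (pairCount j - e j) / pairCount j = W
    rw [hp]
    field_simp
    ring
  linarith

namespace IsSplitGraph

variable {G : SimpleGraph V} {a b : ℕ}

theorem card_eq (h : G.IsSplitGraph a b) : Fintype.card V = a + b := by
  obtain ⟨A, B, hd, hu, rfl, rfl, -⟩ := h
  rw [← card_univ, ← hu, card_union_of_disjoint hd]

theorem connected (h : G.IsSplitGraph a b) (ha : 0 < a) : G.Connected := by
  obtain ⟨A, B, hd, hu, rfl, rfl, hA, hB, hAB⟩ := h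
  obtain ⟨c, hc⟩ := card_pos.mp ha
  have hreach : ∀ v, G.Reachable c v := fun v => by
    have hv : v ∈ A ∪ B := by rw [hu]; exact mem_univ v
    rcases eq_or_ne c v with rfl | hcv
    · exact Reachable.refl _
    rcases mem_union.mp hv with hv | hv
    · exact (hA (mem_coe.mpr hc) (mem_coe.mpr hv) hcv).reachable
    · exact (hAB c hc v hv).reachable
  have : Nonempty V := ⟨c⟩
  exact ⟨fun u v => (hreach u).symm.trans (hreach v)⟩

theorem sigmaTotal_eq [DecidableRel G.Adj] (h : G.IsSplitGraph a b) :
    G.sigmaTotal = a * b * ((b : ℤ) - 1) ^ 2 := by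
  have hcard := h.card_eq
  obtain ⟨A, B, hd, hu, rfl, rfl, hA, hB, hAB⟩ := h
  have hmem : ∀ v, v ∈ A ∨ v ∈ B := fun v => mem_union.mp (by rw [hu]; exact mem_univ v)
  have hdA : ∀ v ∈ A, (G.degree v : ℤ) = #A + #B - 1 := fun v hv => by
    have : G.neighborFinset v = univ.erase v := by
      ext w
      simp only [mem_neighborFinset, mem_erase, mem_univ, and_true]
      refine ⟨fun h => h.ne', fun h => ?_⟩
      rcases hmem w with hw | hw
      · exact hA (mem_coe.mpr hv) (mem_coe.mpr hw) h.symm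
      · exact hAB v hv w hw
    rw [← card_neighborFinset_eq_degree, this, card_erase_of_mem (mem_univ v), card_univ, hcard,
      Nat.cast_sub (by have := card_pos.mpr ⟨v, hv⟩; omega)]
    push_cast; ring
  have hdB : ∀ v ∈ B, (G.degree v : ℤ) = #A := fun v hv => by
    have : G.neighborFinset v = A := by
      ext w
      simp only [mem_neighborFinset]
      refine ⟨fun h => ?_, fun h => (hAB w h v hv).symm⟩
      rcases hmem w with hw | hw
      · exact hw
      · exact absurd h (hB (mem_coe.mpr hv) (mem_coe.mpr hw) h.ne)
    rw [← card_neighborFinset_eq_degree, this]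
  rw [SimpleGraph.sigmaTotal_eq, hcard, ← hu, sum_union hd, sum_union hd, sum_congr rfl hdA,
    sum_congr rfl hdB, sum_congr rfl fun v hv => by rw [hdA v hv],
    sum_congr (s₁ := B) rfl fun v hv => by rw [hdB v hv]]
  simp only [sum_const, nsmul_eq_mul]
  push_cast
  ring

end IsSplitGraph

theorem exists_isSplitGraph {n a b : ℕ} (h : a + b = n) :
    ∃ G : SimpleGraph (Fin n), G.IsSplitGraph a b := by
  refine ⟨SimpleGraph.fromRel fun u _ => (u : ℕ) < a, univ.filter fun u => (u : ℕ) < a,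
    univ.filter fun u => ¬ (u : ℕ) < a, disjoint_filter_filter_not _ _ _,
    filter_union_filter_not_eq _ _, ?_, ?_, ?_, ?_, ?_⟩
  · rw [Fin.card_filter_val_lt]; omega
  · have := card_filter_add_card_filter_not (s := (univ : Finset (Fin n))) fun u => (u : ℕ) < a
    rw [Fin.card_filter_val_lt, card_univ, Fintype.card_fin] at this
    omega
  · intro u hu v hv huv
    simp_all [fromRel_adj]
  · intro u hu v hv huv
    simp_all [fromRel_adj]
  · intro u hu v hv
    simp only [mem_filter, mem_univ, true_and] at hu hv
    rw [fromRel_adj]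
    exact ⟨by rintro rfl; exact hv hu, Or.inl hu⟩

end SimpleGraph

/-! ### Bounding the losses of a build sequence -/

/-- An upper bound for the `σ_t`-irregularity of the graph with build sequence `e`. -/
def buildSigma (n : ℕ) (e : ℕ → ℚ) : ℚ :=
  2 * (n - 2) / (n - 1) * (e n * (pairCount n - e n)) -
    n * ∑ j ∈ range n, e j * (pairCount j - e j) / pairCount j

/-- The `σ_t`-irregularity of the split graph with `b` independent vertices out of `n`. -/
def splitSigma (n b : ℕ) : ℚ := b * (n - b) * (b - 1) ^ 2

theorem pairCount_nonneg (j : ℕ) : 0 ≤ pairCount j := by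
  rcases j with _ | j
  · simp [pairCount]
  · unfold pairCount; push_cast; rw [add_sub_cancel_right]; positivity

namespace IsBuildSeq

variable {n : ℕ} {e : ℕ → ℚ}

theorem compl (h : IsBuildSeq n e) : IsBuildSeq n fun j => pairCount j - e j where
  zero := by simp [h.zero, pairCount]
  step j hj := by
    simp only [pairCount_succ]
    rcases h.step j hj with h | h <;> rw [h]
    · right; ring
    · left; ring

theorem buildSigma_compl (n : ℕ) (e : ℕ → ℚ) :
    buildSigma n (fun j => pairCount j - e j) = buildSigma n e := by
  simp only [buildSigma, sub_sub_cancel]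
  congr 1
  · ring
  · congr 1
    exact sum_congr rfl fun j _ => by ring

theorem exists_nat (h : IsBuildSeq n e) : ∀ j ≤ n, ∃ z : ℕ, e j = z
  | 0, _ => ⟨0, by simp [h.zero]⟩
  | j + 1, hj => by
    obtain ⟨z, hz⟩ := h.exists_nat j (by omega)
    rcases h.step j (by omega) with h | h
    · exact ⟨z, by rw [h, hz]⟩
    · exact ⟨z + j, by rw [h, hz]; push_cast; ring⟩

theorem nonneg (h : IsBuildSeq n e) {j : ℕ} (hj : j ≤ n) : 0 ≤ e j := by
  obtain ⟨z, hz⟩ := h.exists_nat j hj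
  rw [hz]; positivity

theorem mono (h : IsBuildSeq n e) {j : ℕ} (hj : j ≤ n) : e j ≤ e n := by
  have : ∀ k, j ≤ k → k ≤ n → e j ≤ e k := fun k hk => by
    induction k, hk using Nat.le_induction with
    | base => intro _; rfl
    | succ k hk ih =>
      intro hkn
      have := ih (by omega)
      have hk0 : (0 : ℚ) ≤ k := by positivity
      rcases h.step k (by omega) with h | h <;> rw [h] <;> linarith
  exact this n hj le_rfl

/-- Among the first `j` vertices there are at most as many non-edges, and at most as many edges, as
in total; with `hhalf` both totals are at most the number of non-edges. -/
theorem pairCount_sub_le (h : IsBuildSeq n e) (hhalf : 2 * e n ≤ pairCount n) {j : ℕ}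
    (hj : j ≤ n) :
    pairCount j - (pairCount n - e n) ≤ e j ∧
      pairCount j - (pairCount n - e n) ≤ pairCount j - e j := by
  have h1 := h.mono hj
  have h2 := h.compl.mono hj
  constructor <;> linarith

end IsBuildSeq

theorem mul_sub_le_mul_sub_of_le {L x T : ℚ} (h1 : L ≤ x) (h2 : L ≤ T - x) :
    L * (T - L) ≤ x * (T - x) := by
  nlinarith [mul_nonneg (sub_nonneg.mpr h1) (sub_nonneg.mpr h2)]

/-- The least possible contribution of the first `j` vertices to the loss, if the graph has `h`
non-edges. -/
def minLoss (b : ℕ) (h : ℚ) (j : ℕ) : ℚ :=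
  if j ≤ b then 0 else (pairCount j - h) * h / pairCount j

/-- For `j > b` the term is `h - h² / pairCount j`, and `1 / pairCount j = 2 (1 / (j - 1) - 1 / j)`
telescopes. -/
theorem sum_minLoss (b : ℕ) (hb : 1 ≤ b) (h : ℚ) (n : ℕ) (hn : b + 1 ≤ n) :
    ∑ j ∈ range n, minLoss b h j = h * (n - 1 - b) - 2 * h ^ 2 * (1 / b - 1 / (n - 1)) := by
  induction n, hn using Nat.le_induction with
  | base =>
    have h0 : ∀ j ∈ range (b + 1), minLoss b h j = 0 := fun j hj =>
      if_pos (by have := mem_range.mp hj; omega)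
    rw [sum_eq_zero h0]
    push_cast; simp
  | succ n hn ih =>
    rw [sum_range_succ, ih, minLoss, if_neg (by omega), pairCount]
    have h1 : (1 : ℚ) ≤ b := by exact_mod_cast hb
    have h2 : (b : ℚ) + 1 ≤ n := by exact_mod_cast hn
    have h3 : (n : ℚ) - 1 ≠ 0 := by linarith
    have h4 : (n : ℚ) ≠ 0 := by linarith
    have h5 : (b : ℚ) ≠ 0 := by linarith
    push_cast
    rw [add_sub_cancel_right]
    field_simp
    ring

/-- All losses are replaced by their minimum except the one at `i`, whose surplus is kept for later
sharpening; `i = 0` gives the plain bound. The correction vanishes at `r = 0` and equals `splitSigma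
n (b + 1) - splitSigma n b` at `r = b`. -/
theorem IsBuildSeq.buildSigma_le {n b : ℕ} {e : ℕ → ℚ} {r : ℚ} (he : IsBuildSeq n e)
    (hhalf : 2 * e n ≤ pairCount n) (hb : 1 ≤ b) (hbn : b + 1 ≤ n)
    (hr : pairCount n - e n = pairCount b + r) {i : ℕ} (hi : i < n) :
    buildSigma n e ≤ splitSigma n b +
      r * (n * (3 * b - 1) - 4 * b ^ 2 + 2 * (2 * b - n) * (b - r) / b) -
      n * (e i * (pairCount i - e i) / pairCount i - minLoss b (pairCount n - e n) i) := by
  set h := pairCount n - e n with hh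
  have hloss : ∀ j ∈ range n,
      0 ≤ e j * (pairCount j - e j) / pairCount j - minLoss b h j := by
    intro j hj
    have hjn := (mem_range.mp hj).le
    rw [sub_nonneg, minLoss]
    split_ifs with hjb
    · have h1 := he.nonneg hjn
      have h2 := he.compl.nonneg hjn
      exact div_nonneg (mul_nonneg h1 h2) (pairCount_nonneg j)
    · obtain ⟨h1, h2⟩ := he.pairCount_sub_le hhalf hjn
      have := mul_sub_le_mul_sub_of_le h1 h2
      rw [sub_sub_cancel] at this
      exact div_le_div_of_nonneg_right this (pairCount_nonneg j)
  have hs := single_le_sum hloss (mem_range.mpr hi)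
  rw [sum_sub_distrib, sum_minLoss b hb h n hbn] at hs
  have hmul := mul_le_mul_of_nonneg_left hs (Nat.cast_nonneg (α := ℚ) n)
  have h1 : (1 : ℚ) ≤ b := by exact_mod_cast hb
  have h2 : (b : ℚ) + 1 ≤ n := by exact_mod_cast hbn
  have h3 : (n : ℚ) - 1 ≠ 0 := by linarith
  have h5 : (b : ℚ) ≠ 0 := by linarith
  have hen : e n = pairCount n - h := by rw [hh]; ring
  have hF : 2 * ((n : ℚ) - 2) / (n - 1) * (e n * (pairCount n - e n)) -
      n * (h * (n - 1 - b) - 2 * h ^ 2 * (1 / b - 1 / (n - 1))) =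
      splitSigma n b +
        r * (n * (3 * b - 1) - 4 * b ^ 2 + 2 * (2 * b - n) * (b - r) / b) := by
    rw [← hh, hen, hr, splitSigma, pairCount, pairCount]
    field_simp
    ring
  unfold buildSigma
  rw [← hF]
  linarith

/-- A build sequence cannot attain the minimal loss both at `b` and at `b + 1`. -/
theorem IsBuildSeq.loss_dichotomy {n b : ℕ} {e : ℕ → ℚ} {l : ℚ} (he : IsBuildSeq n e)
    (hbn : b + 1 ≤ n) (hl : b ≤ pairCount b - l)
    (h1 : l ≤ e (b + 1)) (h2 : l ≤ pairCount (b + 1) - e (b + 1)) :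
    (l ≤ e b ∧ l ≤ pairCount b - e b) ∨
      ((b : ℚ) ≤ e (b + 1) ∧ (b : ℚ) ≤ pairCount (b + 1) - e (b + 1)) := by
  have h3 := he.nonneg (j := b) (by omega)
  have h4 := he.compl.nonneg (j := b) (by omega)
  rw [pairCount_succ] at *
  -- An isolated new vertex brings `b` non-edges. If fewer than `l` non-edges were present before,
  -- then `hl` forces at least `b` edges. The dominating case is complementary.
  rcases he.step b (by omega) with h | h <;> rw [h] at h1 h2 ⊢
  · by_cases h5 : l ≤ pairCount b - e b
    · exact Or.inl ⟨h1, h5⟩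
    · right; constructor <;> linarith
  · by_cases h5 : l ≤ e b
    · left; constructor <;> linarith
    · right; constructor <;> linarith

theorem exists_pairCount_add (n : ℕ) (hn : 2 ≤ n) (x : ℕ) (hx : (x : ℚ) ≤ pairCount n) :
    ∃ b r : ℕ, 1 ≤ b ∧ b + 1 ≤ n ∧ r ≤ b ∧ (x : ℚ) = pairCount b + r := by
  induction n, hn using Nat.le_induction with
  | base =>
    refine ⟨1, x, le_rfl, le_rfl, ?_, by simp [pairCount]⟩
    norm_num [pairCount] at hx
    exact hx
  | succ n hn ih =>
    by_cases h : (x : ℚ) ≤ pairCount n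
    · obtain ⟨b, r, h1, h2, h3, h4⟩ := ih h
      exact ⟨b, r, h1, by omega, h3, h4⟩
    · have hc : pairCount n = (n.choose 2 : ℕ) := by rw [Nat.cast_choose_two, pairCount]
      rw [pairCount_succ] at hx
      rw [hc] at h hx
      have h' : n.choose 2 < x := by exact_mod_cast not_le.mp h
      have hx' : x ≤ n.choose 2 + n := by exact_mod_cast hx
      refine ⟨n, x - n.choose 2, by omega, le_rfl, by omega, ?_⟩
      rw [hc, Nat.cast_sub h'.le]; ring

theorem splitSigma_succ (n b : ℕ) :
    splitSigma n (b + 1) = splitSigma n b + b * (n * (3 * b - 1) - 4 * b ^ 2) := by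
  unfold splitSigma; push_cast; ring

/-- The improved bound for the number of edges strictly between those of two split graphs. -/
theorem IsBuildSeq.buildSigma_le_gap {n b : ℕ} {e : ℕ → ℚ} {r : ℚ} (he : IsBuildSeq n e)
    (hhalf : 2 * e n ≤ pairCount n) (hb : 2 ≤ b) (hbn : b + 2 ≤ n)
    (hr : pairCount n - e n = pairCount b + r)
    (hl : b ≤ pairCount b - (b - r)) {c : ℚ}
    (hc1 : c ≤ n * ((b - r) * (pairCount b - (b - r)) / pairCount b))
    (hc2 : c ≤ n * (r * (pairCount (b + 1) - 2 * b + r) / pairCount (b + 1))) :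
    buildSigma n e ≤ splitSigma n b +
      r * (n * (3 * b - 1) - 4 * b ^ 2 + 2 * (2 * b - n) * (b - r) / b) - c := by
  obtain ⟨h1, h2⟩ := he.pairCount_sub_le hhalf (j := b + 1) (by omega)
  have hlen : pairCount (b + 1) - (pairCount n - e n) = b - r := by
    rw [hr, pairCount_succ]; ring
  rw [hlen] at h1 h2
  -- Either the loss at `b` is that of `l = b - r` instead of `0`, or the loss at `b + 1` is that of
  -- `b` instead of `b - r`; `hc1` and `hc2` compare `c` with these two surpluses.
  rcases he.loss_dichotomy (by omega) hl h1 h2 with ⟨h3, h4⟩ | ⟨h3, h4⟩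
  · have := he.buildSigma_le hhalf (by omega) (by omega) hr (i := b) (by omega)
    refine this.trans (sub_le_sub_left (hc1.trans ?_) _)
    gcongr
    rw [minLoss, if_pos le_rfl, sub_zero]
    exact div_le_div_of_nonneg_right (mul_sub_le_mul_sub_of_le h3 h4) (pairCount_nonneg b)
  · have := he.buildSigma_le hhalf (by omega) (by omega) hr (i := b + 1) (by omega)
    refine this.trans (sub_le_sub_left (hc2.trans ?_) _)
    gcongr
    rw [minLoss, if_neg (by omega), hlen, ← sub_div]
    refine div_le_div_of_nonneg_right ?_ (pairCount_nonneg _)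
    have h5 := mul_sub_le_mul_sub_of_le h3 h4
    have h6 : pairCount n - e n = pairCount (b + 1) - (b - r) := by linarith
    rw [h6]
    nlinarith

/-- The estimates behind the bound for `n = 4m + 2` vertices. -/
theorem gap_two_estimates {m : ℕ} {r : ℚ} (hm : (1 : ℚ) ≤ m) (hr : 3 * (m : ℚ) + 1 < 2 * r)
    (hrb : r ≤ 3 * (m : ℚ) + 1) :
    (3 * (m : ℚ) + 1 ≤ pairCount (3 * m + 1) - (3 * m + 1 - r)) ∧
    2 * (m : ℚ) * (3 * m + 1 - r) * (2 * r - (3 * m + 1)) / (3 * m + 1) ≤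
      (4 * m + 2) * ((3 * m + 1 - r) * ((3 * m + 1) * (3 * m + 1 - 1) / 2 - (3 * m + 1 - r)) /
        ((3 * m + 1) * (3 * m + 1 - 1) / 2)) ∧
    2 * (m : ℚ) * (3 * m + 1 - r) * (2 * r - (3 * m + 1)) / (3 * m + 1) ≤
      (4 * m + 2) * (r * ((3 * m + 1 + 1) * (3 * m + 1 + 1 - 1) / 2 - 2 * (3 * m + 1) + r) /
        ((3 * m + 1 + 1) * (3 * m + 1 + 1 - 1) / 2)) := by
  rw [pairCount]
  push_cast
  generalize (m : ℚ) = m at *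
  have hb : 0 < 3 * m + 1 := by linarith
  have hl : 0 ≤ 3 * m + 1 - r := by linarith
  have hup : 2 * m * (3 * m + 1 - r) * (2 * r - (3 * m + 1)) / (3 * m + 1) ≤
      2 * m * (3 * m + 1 - r) := by
    rw [div_le_iff₀ hb]
    exact mul_le_mul_of_nonneg_left (by linarith) (mul_nonneg (by linarith) hl)
  refine ⟨by nlinarith, hup.trans ?_, hup.trans ?_⟩
  · have hT : 0 < (3 * m + 1) * (3 * m + 1 - 1) / 2 := by nlinarith
    rw [mul_div_assoc', le_div_iff₀ hT]
    have : 2 * m * ((3 * m + 1) * (3 * m + 1 - 1) / 2) ≤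
        (4 * m + 2) * ((3 * m + 1) * (3 * m + 1 - 1) / 2 - (3 * m + 1 - r)) := by
      nlinarith
    nlinarith [mul_le_mul_of_nonneg_left this hl]
  · have hT : 0 < (3 * m + 1 + 1) * (3 * m + 1 + 1 - 1) / 2 := by nlinarith
    rw [mul_div_assoc', le_div_iff₀ hT]
    have h1 : 2 * m * (3 * m + 1 - r) ≤ 2 * m * r :=
      mul_le_mul_of_nonneg_left (by linarith) (by linarith)
    -- Here `r` is replaced by its lower bound `(3m + 1) / 2`, which leaves a polynomial inequality
    -- in `m` alone.
    have h2 : 2 * m * ((3 * m + 1 + 1) * (3 * m + 1 + 1 - 1) / 2) ≤ (4 * m + 2) *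
        ((3 * m + 1 + 1) * (3 * m + 1 + 1 - 1) / 2 - 2 * (3 * m + 1) + (3 * m + 1) / 2) := by
      nlinarith [mul_nonneg (sub_nonneg.mpr hm) (sub_nonneg.mpr hm),
        mul_nonneg (mul_nonneg (sub_nonneg.mpr hm) (sub_nonneg.mpr hm)) (sub_nonneg.mpr hm)]
    have h3 : 2 * m * ((3 * m + 1 + 1) * (3 * m + 1 + 1 - 1) / 2) ≤ (4 * m + 2) *
        ((3 * m + 1 + 1) * (3 * m + 1 + 1 - 1) / 2 - 2 * (3 * m + 1) + r) :=
      h2.trans (mul_le_mul_of_nonneg_left (by linarith) (by linarith))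
    have h4 := mul_le_mul_of_nonneg_right h1 hT.le
    have h5 := mul_le_mul_of_nonneg_left h3 (show 0 ≤ r by linarith)
    linarith

/-- The estimates behind the bound for `n = 4m + 3` vertices. -/
theorem gap_three_estimates {m : ℕ} {r : ℚ} (hm : (1 : ℚ) ≤ m) (hr : 1 ≤ r)
    (hrb : r ≤ 3 * (m : ℚ) + 2) :
    (3 * (m : ℚ) + 2 ≤ pairCount (3 * m + 2) - (3 * m + 2 - r)) ∧
    r * (-((m : ℚ) + 1) + (4 * m + 2) * (3 * m + 2 - r) / (3 * m + 2)) ≤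
      (4 * m + 3) * ((3 * m + 2 - r) * ((3 * m + 2) * (3 * m + 2 - 1) / 2 - (3 * m + 2 - r)) /
        ((3 * m + 2) * (3 * m + 2 - 1) / 2)) ∧
    r * (-((m : ℚ) + 1) + (4 * m + 2) * (3 * m + 2 - r) / (3 * m + 2)) ≤
      (4 * m + 3) * (r * ((3 * m + 2 + 1) * (3 * m + 2 + 1 - 1) / 2 - 2 * (3 * m + 2) + r) /
        ((3 * m + 2 + 1) * (3 * m + 2 + 1 - 1) / 2)) := by
  rw [pairCount]
  push_cast
  generalize (m : ℚ) = m at *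
  have hb : 0 < 3 * m + 2 := by linarith
  have hl : 0 ≤ 3 * m + 2 - r := by linarith
  have hr0 : 0 ≤ r := by linarith
  refine ⟨by nlinarith, ?_, ?_⟩
  · have hT : 0 < (3 * m + 2) * (3 * m + 2 - 1) / 2 := by nlinarith
    -- With `b = 3m + 2` and `l = b - r` this is `1 - l / b ≤ 1 - l / pairCount b`, true because `b
    -- ≤ pairCount b`.
    have h1 : r / (3 * m + 2) ≤ ((3 * m + 2) * (3 * m + 2 - 1) / 2 - (3 * m + 2 - r)) /
        ((3 * m + 2) * (3 * m + 2 - 1) / 2) := by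
      rw [div_le_div_iff₀ hb hT]
      nlinarith [mul_nonneg (mul_nonneg hl hb.le) (sub_nonneg.mpr hm)]
    have h2 : r * (-(m + 1) + (4 * m + 2) * (3 * m + 2 - r) / (3 * m + 2)) ≤
        (4 * m + 3) * ((3 * m + 2 - r) * (r / (3 * m + 2))) := by
      have : (4 * m + 3) * ((3 * m + 2 - r) * (r / (3 * m + 2))) -
          r * (-(m + 1) + (4 * m + 2) * (3 * m + 2 - r) / (3 * m + 2)) =
          r * (m + 1) + r * (3 * m + 2 - r) / (3 * m + 2) := by
        field_simp
        ring
      have h3 : 0 ≤ r * (m + 1) + r * (3 * m + 2 - r) / (3 * m + 2) := by positivity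
      linarith
    refine h2.trans ?_
    rw [mul_div_assoc]
    gcongr
  · rw [mul_div_assoc r, mul_left_comm (4 * m + 3)]
    gcongr
    have hT : 0 < (3 * m + 2 + 1) * (3 * m + 2 + 1 - 1) / 2 := by nlinarith
    rw [← sub_nonneg]
    have : (4 * m + 3) * (((3 * m + 2 + 1) * (3 * m + 2 + 1 - 1) / 2 - 2 * (3 * m + 2) + r) /
        ((3 * m + 2 + 1) * (3 * m + 2 + 1 - 1) / 2)) -
        (-(m + 1) + (4 * m + 2) * (3 * m + 2 - r) / (3 * m + 2)) =
        ((m + 2) * (3 * m + 2) * (3 * m + 3) + (4 * m + 2) * (3 * m + 3) * r -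
          (4 * m + 3) * (4 * (3 * m + 2) - 2 * r)) / ((3 * m + 2) * (3 * m + 3)) := by
      have h3 : 3 * m + 3 ≠ 0 := by linarith
      have h4 : (3 * m + 2 + 1) * (3 * m + 2 + 1 - 1) / 2 = (3 * m + 3) * (3 * m + 2) / 2 := by
        ring
      rw [h4]
      field_simp
      ring
    rw [this]
    apply div_nonneg _ (by nlinarith)
    nlinarith [mul_nonneg (sub_nonneg.mpr hm) (sub_nonneg.mpr hm),
      mul_nonneg (sub_nonneg.mpr hm) (sub_nonneg.mpr hr),
      mul_nonneg (mul_nonneg (sub_nonneg.mpr hm) (sub_nonneg.mpr hm)) (sub_nonneg.mpr hm),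
      mul_nonneg (mul_nonneg (sub_nonneg.mpr hm) (sub_nonneg.mpr hm)) (sub_nonneg.mpr hr)]

/-! ### Comparison with split graphs -/

theorem IsBuildSeq.exists_buildSigma_le_splitSigma {n : ℕ} (hn : 3 ≤ n) {e : ℕ → ℚ}
    (he : IsBuildSeq n e) : ∃ c : ℕ, 1 ≤ c ∧ buildSigma n e ≤ splitSigma n c := by
  wlog hhalf : 2 * e n ≤ pairCount n generalizing e
  · rw [← IsBuildSeq.buildSigma_compl]
    exact this he.compl (by linarith)
  obtain ⟨x, hx⟩ := he.compl.exists_nat n le_rfl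
  have hen := he.nonneg le_rfl
  obtain ⟨b, r, hb, hbn, hrb, hr⟩ := exists_pairCount_add n (by omega) x (by linarith)
  rw [← hx] at hr
  have hb' : (1 : ℚ) ≤ b := by exact_mod_cast hb
  have hrb' : (r : ℚ) ≤ b := by exact_mod_cast hrb
  have hr0 : (0 : ℚ) ≤ r := by positivity
  have hbpos : (0 : ℚ) < b := by linarith
  have hn' : (3 : ℚ) ≤ n := by exact_mod_cast hn
  -- At least half of the pairs are non-edges, and these number at most `pairCount (b + 1)`. The
  -- inequality makes the correction concave in `r`.
  have hn2b : n ≤ 2 * b := by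
    by_contra hlt
    have h1 : (2 : ℚ) * b + 1 ≤ n := by exact_mod_cast (by omega : 2 * b + 1 ≤ n)
    have h2 : pairCount n ≤ 2 * (pairCount b + b) := by linarith
    unfold pairCount at h2
    nlinarith
  have hn2b' : (n : ℚ) ≤ 2 * b := by exact_mod_cast hn2b
  have hbase : buildSigma n e ≤ splitSigma n b +
      r * (n * (3 * b - 1) - 4 * b ^ 2 + 2 * (2 * b - n) * (b - r) / b) := by
    have := he.buildSigma_le hhalf hb hbn hr (i := 0) (by omega)
    simpa [minLoss, he.zero] using this
  -- The slope of the correction at `r = 0` is `(b - 1) (3n - 4b)`; if it is at most zero, concavity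
  -- makes `r = 0` optimal.
  by_cases hlarge : 3 * n ≤ 4 * b
  · refine ⟨b, hb, hbase.trans ?_⟩
    have hlarge' : (3 : ℚ) * n ≤ 4 * b := by exact_mod_cast hlarge
    have h1 : 2 * (2 * (b : ℚ) - n) * (b - r) / b ≤ 2 * (2 * b - n) := by
      rw [div_le_iff₀ hbpos]
      nlinarith [mul_nonneg (sub_nonneg.mpr hn2b') hr0]
    have h2 : ((n : ℚ) * (3 * b - 1) - 4 * b ^ 2 + 2 * (2 * b - n) * (b - r) / b) ≤ 0 := by
      nlinarith [mul_nonneg (sub_nonneg.mpr hb') (sub_nonneg.mpr hlarge')]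
    nlinarith [mul_nonneg hr0 (neg_nonneg.mpr h2)]
  -- The slope at `r = b` is `n (3b + 1) - 4b (b + 1)`; if it is nonnegative, `r = b` is optimal,
  -- and `h3` measures the correction from that end.
  by_cases hsmall : 4 * b * (b + 1) ≤ n * (3 * b + 1)
  · refine ⟨b + 1, by omega, hbase.trans ?_⟩
    have hsmall' : 4 * (b : ℚ) * (b + 1) ≤ n * (3 * b + 1) := by exact_mod_cast hsmall
    rw [splitSigma_succ]
    have h1 : 2 * (2 * (b : ℚ) - n) * r / b ≤ 2 * (2 * b - n) := by
      rw [div_le_iff₀ hbpos]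
      nlinarith [mul_nonneg (sub_nonneg.mpr hn2b') (sub_nonneg.mpr hrb')]
    have h2 : 0 ≤ ((n : ℚ) * (3 * b - 1) - 4 * b ^ 2 - 2 * (2 * b - n) * r / b) := by
      nlinarith
    have h3 : (r : ℚ) * (n * (3 * b - 1) - 4 * b ^ 2 + 2 * (2 * b - n) * (b - r) / b) =
        b * (n * (3 * b - 1) - 4 * b ^ 2) -
          (b - r) * (n * (3 * b - 1) - 4 * b ^ 2 - 2 * (2 * b - n) * r / b) := by
      field_simp
      ring
    rw [h3]
    nlinarith [mul_nonneg (sub_nonneg.mpr hrb') h2]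
  have hb4 : 3 * n < 4 * (b + 1) := by
    by_contra h
    exact hsmall (by nlinarith)
  obtain ⟨m, hm⟩ : ∃ m, (n = 4 * m + 2 ∧ b = 3 * m + 1 ∧ 1 ≤ m) ∨
      (n = 4 * m + 3 ∧ b = 3 * m + 2) := by
    refine ⟨n / 4, ?_⟩
    have h4 : n % 4 ≠ 1 := fun h => by
      obtain ⟨m, rfl⟩ : ∃ m, n = 4 * m + 1 := ⟨n / 4, by omega⟩
      obtain rfl : b = 3 * m := by omega
      exact hsmall (by nlinarith)
    omega
  rcases hm with ⟨rfl, rfl, hm⟩ | ⟨rfl, rfl⟩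
  · refine ⟨3 * m + 1 + 1, by omega, ?_⟩
    have hm' : (1 : ℚ) ≤ m := by exact_mod_cast hm
    have hexc : splitSigma (4 * m + 2) (3 * m + 1) + r * (((4 * m + 2 : ℕ) : ℚ) *
          (3 * ((3 * m + 1 : ℕ) : ℚ) - 1) - 4 * ((3 * m + 1 : ℕ) : ℚ) ^ 2 +
          2 * (2 * ((3 * m + 1 : ℕ) : ℚ) - ((4 * m + 2 : ℕ) : ℚ)) *
            (((3 * m + 1 : ℕ) : ℚ) - r) / ((3 * m + 1 : ℕ) : ℚ)) =
        splitSigma (4 * m + 2) (3 * m + 1 + 1) +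
          2 * m * (3 * m + 1 - r) * (2 * r - (3 * m + 1)) / (3 * m + 1) := by
      rw [splitSigma_succ _ (3 * m + 1)]
      push_cast
      field_simp
      ring
    rw [hexc] at hbase
    -- The excess over the value at `b + 1` has the factor `2r - b`, so the sharper bound is needed
    -- only for `r > b / 2`.
    by_cases hr2 : 2 * r ≤ 3 * m + 1
    · refine hbase.trans (add_le_of_nonpos_right ?_)
      have hr2' : 2 * (r : ℚ) ≤ 3 * m + 1 := by exact_mod_cast hr2
      push_cast at hrb'
      refine div_nonpos_of_nonpos_of_nonneg (mul_nonpos_of_nonneg_of_nonpos ?_ ?_) (by positivity)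
      · exact mul_nonneg (by positivity) (by linarith)
      · linarith
    · have hr2' : 3 * (m : ℚ) + 1 < 2 * r := by exact_mod_cast not_le.mp hr2
      push_cast at hrb'
      obtain ⟨hc0, hc1, hc2⟩ := gap_two_estimates hm' hr2' hrb'
      have := he.buildSigma_le_gap hhalf (by omega) (by omega) hr
        (c := 2 * m * (3 * m + 1 - r) * (2 * r - (3 * m + 1)) / (3 * m + 1))
        (by push_cast; exact hc0) (by rw [pairCount]; push_cast; exact hc1)
        (by rw [pairCount]; push_cast; exact hc2)
      rw [hexc] at this
      linarith
  · refine ⟨3 * m + 2, by omega, ?_⟩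
    have hexc : (r : ℚ) * (((4 * m + 3 : ℕ) : ℚ) *
          (3 * ((3 * m + 2 : ℕ) : ℚ) - 1) - 4 * ((3 * m + 2 : ℕ) : ℚ) ^ 2 +
          2 * (2 * ((3 * m + 2 : ℕ) : ℚ) - ((4 * m + 3 : ℕ) : ℚ)) *
            (((3 * m + 2 : ℕ) : ℚ) - r) / ((3 * m + 2 : ℕ) : ℚ)) =
          r * (-(m + 1) + (4 * m + 2) * (3 * m + 2 - r) / (3 * m + 2)) := by
      push_cast
      field_simp
      ring
    rw [hexc] at hbase
    rcases Nat.eq_zero_or_pos r with rfl | hrpos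
    · simpa using hbase
    have hr1 : (1 : ℚ) ≤ r := by exact_mod_cast hrpos
    push_cast at hrb'
    -- For `m = 0`, that is `n = 3` and `b = 2`, the correction is `r (1 - r)`, already nonpositive
    -- for `r ≥ 1`.
    rcases Nat.eq_zero_or_pos m with rfl | hm
    · refine hbase.trans (add_le_of_nonpos_right ?_)
      norm_num
      nlinarith
    have hm' : (1 : ℚ) ≤ m := by exact_mod_cast hm
    obtain ⟨hc0, hc1, hc2⟩ := gap_three_estimates hm' hr1 hrb'
    have := he.buildSigma_le_gap hhalf (by omega) (by omega) hr
      (c := r * (-(m + 1) + (4 * m + 2) * (3 * m + 2 - r) / (3 * m + 2)))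
      (by push_cast; exact hc0) (by rw [pairCount]; push_cast; exact hc1)
      (by rw [pairCount]; push_cast; exact hc2)
    rw [hexc] at this
    linarith

/-! ### Locating the best split graph -/

/-- By `splitSigma_succ`, `hlo` and `hhi` give the sign of the increment from `b` to `b + 1` before
and after `p`. -/
theorem splitSigma_le_of_unimodal {n p : ℕ}
    (hlo : ∀ b : ℕ, 1 ≤ b → b < p → 4 * b ^ 2 + n ≤ n * (3 * b))
    (hhi : ∀ b : ℕ, p ≤ b → n * (3 * b) ≤ 4 * b ^ 2 + n) {c : ℕ} (hc : 1 ≤ c) :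
    splitSigma n c ≤ splitSigma n p := by
  rcases le_total c p with h | h
  · have key : ∀ k, c ≤ k → k ≤ p → splitSigma n c ≤ splitSigma n k := fun k hk => by
      induction k, hk using Nat.le_induction with
      | base => intro _; rfl
      | succ k hk ih =>
        intro hkp
        refine (ih (by omega)).trans ?_
        have h1 : 4 * (k : ℚ) ^ 2 + n ≤ n * (3 * k) := by
          exact_mod_cast hlo k (by omega) (by omega)
        rw [splitSigma_succ]
        exact le_add_of_nonneg_right (mul_nonneg (by positivity) (by linarith))
    exact key p h le_rfl
  · clear hc
    induction c, h using Nat.le_induction with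
    | base => rfl
    | succ c hc ih =>
      refine le_trans ?_ ih
      have h1 : (n : ℚ) * (3 * c) ≤ 4 * c ^ 2 + n := by exact_mod_cast hhi c hc
      rw [splitSigma_succ]
      exact add_le_of_nonpos_right (mul_nonpos_of_nonneg_of_nonpos (by positivity) (by linarith))

/-- The upper bound for the `σ_t`-irregularity in terms of the position of the maximum. -/
theorem SimpleGraph.sigmaTotal_le_of_unimodal {V : Type*} [Fintype V] [DecidableEq V]
    (G : SimpleGraph V) [DecidableRel G.Adj] {n a p : ℕ} (hn : 3 ≤ n) (hV : Fintype.card V = n)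
    (hap : a + p = n)
    (hlo : ∀ b : ℕ, 1 ≤ b → b < p → 4 * b ^ 2 + n ≤ n * (3 * b))
    (hhi : ∀ b : ℕ, p ≤ b → n * (3 * b) ≤ 4 * b ^ 2 + n) :
    G.sigmaTotal ≤ a * p * ((p : ℤ) - 1) ^ 2 := by
  obtain ⟨e, he, hle⟩ := G.exists_isBuildSeq_sigmaTotal_le n (by omega) hV
  obtain ⟨c, hc, hle'⟩ := he.exists_buildSigma_le_splitSigma hn
  have h := (hle.trans hle').trans (splitSigma_le_of_unimodal hlo hhi hc)
  have hs : splitSigma n p = ((a * p * ((p : ℤ) - 1) ^ 2 : ℤ) : ℚ) := by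
    rw [splitSigma, ← hap]; push_cast; ring
  rw [hs] at h
  exact_mod_cast h

/-- The maximality, the value and the existence of the extremal split graph. -/
theorem SimpleGraph.sigmaTotal_extremal {n a p : ℕ} (hn : 3 ≤ n) (hap : a + p = n) (ha : 0 < a)
    (hlo : ∀ b : ℕ, 1 ≤ b → b < p → 4 * b ^ 2 + n ≤ n * (3 * b))
    (hhi : ∀ b : ℕ, p ≤ b → n * (3 * b) ≤ 4 * b ^ 2 + n) :
    (∀ (V : Type*) [Fintype V] [DecidableEq V] (G : SimpleGraph V) [DecidableRel G.Adj],
      Fintype.card V = n → G.Connected → G.sigmaTotal ≤ a * p * ((n : ℤ) - 1 - a) ^ 2) ∧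
    (∀ (V : Type*) [Fintype V] [DecidableEq V] (G : SimpleGraph V) [DecidableRel G.Adj],
      G.IsSplitGraph a p → Fintype.card V = n ∧ G.Connected ∧
        G.sigmaTotal = a * p * ((n : ℤ) - 1 - a) ^ 2) ∧
    ∃ G : SimpleGraph (Fin n), G.IsSplitGraph a p := by
  have hp : (n : ℤ) - 1 - a = p - 1 := by rw [← hap]; push_cast; ring
  rw [hp]
  exact ⟨fun V _ _ G _ hV _ => G.sigmaTotal_le_of_unimodal hn hV hap hlo hhi,
    fun V _ _ G _ hG => ⟨hG.card_eq.trans hap, hG.connected ha, hG.sigmaTotal_eq⟩,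
    exists_isSplitGraph hap⟩

/-- The sign in question is that of `b (3n - 4b) - n`. This lemma and the next leave open only `4b <
3n < 4b + 4`, where the residue of `n` modulo `4` decides. -/
theorem three_mul_le_of_le {n b : ℕ} (h : 3 * n ≤ 4 * b) : n * (3 * b) ≤ 4 * b ^ 2 + n := by
  nlinarith

theorem le_three_mul_of_le {n b : ℕ} (hb : 1 ≤ b) (h : 4 * (b + 1) ≤ 3 * n) :
    4 * b ^ 2 + n ≤ n * (3 * b) := by
  rcases le_total n (4 * b) with h1 | h1
  · nlinarith
  · nlinarith

theorem theorem3p1 (n : ℕ) (hn : 3 ≤ n) :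
    (n % 4 = 0 ∨ n % 4 = 3 →
      (∀ (V : Type*) [Fintype V] [DecidableEq V] (G : SimpleGraph V) [DecidableRel G.Adj],
        Fintype.card V = n → G.Connected →
          G.sigmaTotal ≤ ⌈(n : ℚ) / 4⌉ * ⌊3 * (n : ℚ) / 4⌋ * ((n : ℤ) - 1 - ⌈(n : ℚ) / 4⌉) ^ 2) ∧
      (∀ (V : Type*) [Fintype V] [DecidableEq V] (G : SimpleGraph V) [DecidableRel G.Adj],
        G.IsSplitGraph ⌈(n : ℚ) / 4⌉₊ ⌊3 * (n : ℚ) / 4⌋₊ →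
          Fintype.card V = n ∧ G.Connected ∧
          G.sigmaTotal = ⌈(n : ℚ) / 4⌉ * ⌊3 * (n : ℚ) / 4⌋ * ((n : ℤ) - 1 - ⌈(n : ℚ) / 4⌉) ^ 2) ∧
      (∃ G : SimpleGraph (Fin n), G.IsSplitGraph ⌈(n : ℚ) / 4⌉₊ ⌊3 * (n : ℚ) / 4⌋₊)) ∧
    (n % 4 = 1 ∨ n % 4 = 2 →
      (∀ (V : Type*) [Fintype V] [DecidableEq V] (G : SimpleGraph V) [DecidableRel G.Adj],
        Fintype.card V = n → G.Connected →
          G.sigmaTotal ≤ ⌊(n : ℚ) / 4⌋ * ⌈3 * (n : ℚ) / 4⌉ * ((n : ℤ) - 1 - ⌊(n : ℚ) / 4⌋) ^ 2) ∧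
      (∀ (V : Type*) [Fintype V] [DecidableEq V] (G : SimpleGraph V) [DecidableRel G.Adj],
        G.IsSplitGraph ⌊(n : ℚ) / 4⌋₊ ⌈3 * (n : ℚ) / 4⌉₊ →
          Fintype.card V = n ∧ G.Connected ∧
          G.sigmaTotal = ⌊(n : ℚ) / 4⌋ * ⌈3 * (n : ℚ) / 4⌉ * ((n : ℤ) - 1 - ⌊(n : ℚ) / 4⌋) ^ 2) ∧
      (∃ G : SimpleGraph (Fin n), G.IsSplitGraph ⌊(n : ℚ) / 4⌋₊ ⌈3 * (n : ℚ) / 4⌉₊)) := by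
  obtain ⟨k, hk⟩ : ∃ k, n = 4 * k + n % 4 := ⟨n / 4, (Nat.div_add_mod n 4).symm⟩
  have hnq : (n : ℚ) = 4 * k + (n % 4 : ℕ) := by exact_mod_cast hk
  constructor
  · intro hmod
    obtain ⟨a, p, hap, ha, hceil, hfloor, hp1, hp2⟩ : ∃ a p : ℕ, a + p = n ∧ 0 < a ∧
        ⌈(n : ℚ) / 4⌉ = a ∧ ⌊3 * (n : ℚ) / 4⌋ = p ∧ 4 * p ≤ 3 * n ∧ 3 * n ≤ 4 * p + 1 := by
      rcases hmod with h | h <;> rw [h] at hk hnq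
      · refine ⟨k, 3 * k, by omega, by omega, ?_, ?_, by omega, by omega⟩
        · rw [Int.ceil_eq_iff, hnq]; push_cast; constructor <;> linarith
        · rw [Int.floor_eq_iff, hnq]; push_cast; constructor <;> linarith
      · refine ⟨k + 1, 3 * k + 2, by omega, by omega, ?_, ?_, by omega, by omega⟩
        · rw [Int.ceil_eq_iff, hnq]; push_cast; constructor <;> linarith
        · rw [Int.floor_eq_iff, hnq]; push_cast; constructor <;> linarith
    rw [← Int.ceil_toNat, ← Int.floor_toNat, hceil, hfloor, Int.toNat_natCast, Int.toNat_natCast]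
    refine SimpleGraph.sigmaTotal_extremal hn hap ha
      (fun b h1 h2 => le_three_mul_of_le h1 (by omega)) fun b hb => ?_
    rcases hmod with h | h
    · exact three_mul_le_of_le (by omega)
    -- For `n = 4m + 3` the undecided value is `b = p = 3m + 2`, where `b (3n - 4b) - n = -(m + 1)`.
    · rcases hb.eq_or_lt with rfl | hb
      · obtain ⟨m, rfl⟩ : ∃ m, n = 4 * m + 3 := ⟨n / 4, by omega⟩
        obtain rfl : p = 3 * m + 2 := by omega
        nlinarith
      · exact three_mul_le_of_le (by omega)
  · intro hmod
    obtain ⟨a, p, hap, ha, hfloor, hceil, hp1, hp2⟩ : ∃ a p : ℕ, a + p = n ∧ 0 < a ∧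
        ⌊(n : ℚ) / 4⌋ = a ∧ ⌈3 * (n : ℚ) / 4⌉ = p ∧ 3 * n ≤ 4 * p ∧ 4 * p ≤ 3 * n + 2 := by
      rcases hmod with h | h <;> rw [h] at hk hnq
      · refine ⟨k, 3 * k + 1, by omega, by omega, ?_, ?_, by omega, by omega⟩
        · rw [Int.floor_eq_iff, hnq]; push_cast; constructor <;> linarith
        · rw [Int.ceil_eq_iff, hnq]; push_cast; constructor <;> linarith
      · refine ⟨k, 3 * k + 2, by omega, by omega, ?_, ?_, by omega, by omega⟩
        · rw [Int.floor_eq_iff, hnq]; push_cast; constructor <;> linarith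
        · rw [Int.ceil_eq_iff, hnq]; push_cast; constructor <;> linarith
    rw [← Int.ceil_toNat, ← Int.floor_toNat, hceil, hfloor, Int.toNat_natCast, Int.toNat_natCast]
    refine SimpleGraph.sigmaTotal_extremal hn hap ha
      (fun b h1 h2 => ?_) fun b hb => three_mul_le_of_le (by omega)
    -- The undecided value is `b = p - 1`: there `b (3n - 4b) - n` is `5m - 1` for `n = 4m + 1` and
    -- `2m` for `n = 4m + 2`.
    rcases (Nat.succ_le_of_lt h2).eq_or_lt with hb | hb
    · rcases hmod with h | h
      · obtain ⟨m, rfl⟩ : ∃ m, n = 4 * m + 1 := ⟨n / 4, by omega⟩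
        obtain rfl : b = 3 * m := by omega
        nlinarith
      · obtain ⟨m, rfl⟩ : ∃ m, n = 4 * m + 2 := ⟨n / 4, by omega⟩
        obtain rfl : b = 3 * m + 1 := by omega
        nlinarith
    · exact le_three_mul_of_le h1 (by omega)
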